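/- \textbf{Theorem.} Let $d\ge 1$. For $x\in\mathbb{R}$ let $\|x\|$ be the distance from $x$ to the nearest integer, let $|\mathbf{t}|_\infty=\max_i|t_i|$ for $\mathbf{t}\in\mathbb{R}^d$, and put $\log_+x=\max\{1,\log x\}$ for $x>0$. For a real $d\times d$ matrix $M$ let $\sigma(M)=\inf\{\|Mx\|_2 : \|x\|_2=1\}$ be its smallest singular value. Let $\mathbf{r}=(r_1,\dots,r_d)$ be a $d$-tuple of non-increasing functions $r_i\colon\{1,2,3,\dots\}\to(0,\tfrac12)$ that is doubling: there is $C>1$ with $r_i(n)\le C\,r_i(2n)$ for all $1\le i\le d$ and all $n\ge1$. Let $\mathcal{A}=(A_n)_{n\ge1}$ be a sequence of integral $d\times d$ matrices, and assume that for some $c,s,\varepsilon>0$ we have $$\sigma(A_n-A_m)\ \ge\ c\,|n-m|^{1/s}\,(\log_+|n-m|)^{1/s+\varepsilon}\qquad\text{for all } m,n\ge 1 \text{ with } m\neq n.$$ Let $\mu$ be a Borel probability measure on $[0,1)^d$ whose Fourier transform $\widehat\mu(\mathbf{t})=\int e^{-2\pi i\langle \mathbf{t},\mathbf{x}\rangle}\,d\mu(\mathbf{x})$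 satisfies $$\widehat\mu(\mathbf{t})=O\big(|\mathbf{t}|_\infty^{-s}\big)\qquad\text{as } |\mathbf{t}|_\infty\to\infty,$$ with the same exponent $s$. For $\boldsymbol\alpha\in[0,1)^d$ let $\mathcal{T}_{\boldsymbol\alpha}(\mathcal{A},\mathbf{r})$ be the set of $\boldsymbol\beta\in[0,1)^d$ such that, for infinitely many $n\ge1$, $A_n\boldsymbol\alpha\in\boldsymbol\beta+\mathcal{R}_n(\mathbf{r})\pmod 1$ (that is, modulo $\mathbb{Z}^d$), where $\mathcal{R}_n(\mathbf{r})=\{\mathbf{x}\in[0,1)^d:\|x_i\|\le r_i(n),\ 1\le i\le d\}$. Then, for $\mu$-almost every $\boldsymbol\alpha$, the $d$-dimensional Lebesgue measure of this set is $$\mathcal{L}^d\big(\mathcal{T}_{\boldsymbol\alpha}(\mathcal{A},\mathbf{r})\big)=\begin{cases}0 & \text{if } \sum_{n=1}^\infty\prod_{i=1}^d r_i(n)<\infty,\\ 1 & \text{if } \sum_{n=1}^\infty\prod_{i=1}^d r_i(n)=\infty.\end{cases}$$ -/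

import Mathlib

open MeasureTheory Filter Set
open scoped Matrix Asymptotics

namespace TwistedApprox

noncomputable section

/-- The unit cube `[0,1)^d`. -/
def unitCube (d : ℕ) : Set (Fin d → ℝ) := {x | ∀ i, x i ∈ Set.Ico (0 : ℝ) 1}

/-- The distance from a real number to the nearest integer. -/
def distInt (x : ℝ) : ℝ := |x - (round x : ℝ)|

/-- `log_+ x = max {1, log x}`. -/
def logPlus (x : ℝ) : ℝ := max 1 (Real.log x)

/-- The smallest singular value of a real square matrix, as the infimum of the Euclidean norm
`‖A x‖₂` over all vectors `x` with `‖x‖₂ = 1`. -/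
def smallestSingularValue {d : ℕ} (A : Matrix (Fin d) (Fin d) ℝ) : ℝ :=
  sInf {y : ℝ | ∃ x : Fin d → ℝ, ‖WithLp.toLp 2 x‖ = 1 ∧ y = ‖WithLp.toLp 2 (A *ᵥ x)‖}

/-- The Fourier transform `μ̂(t) = ∫ exp(-2πi⟨t, x⟩) dμ(x)` of a measure on `ℝ^d`. -/
def fourierTransform {d : ℕ} (μ : Measure (Fin d → ℝ)) (t : Fin d → ℝ) : ℂ :=
  ∫ x, Complex.exp (-2 * Real.pi * Complex.I * ((t ⬝ᵥ x : ℝ) : ℂ)) ∂μ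

/-- A tuple of functions on the positive integers is doubling if every coordinate is non-increasing
and one constant `C > 1` satisfies `r_i(n) ≤ C r_i(2n)` for all `i` and `n`. -/
def IsDoubling {d : ℕ} (r : ℕ+ → Fin d → ℝ) : Prop :=
  (∀ i, Antitone fun n => r n i) ∧ ∃ C : ℝ, 1 < C ∧ ∀ i n, r n i ≤ C * r (2 * n) i

/-- The target set `R_n(r)` of those `x ∈ [0,1)^d` for which the distance from `x_i` to the nearest
integer is at most `r_i(n)` for every `i`. -/
def targetSet {d : ℕ} (r : ℕ+ → Fin d → ℝ) (n : ℕ+) : Set (Fin d → ℝ) :=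
  {x | x ∈ unitCube d ∧ ∀ i, distInt (x i) ≤ r n i}

/-- The set `T_α(A, r)` of those `β ∈ [0,1)^d` such that `A_n α ∈ β + R_n(r) (mod 1)` for infinitely
many `n ≥ 1`; a congruence modulo 1 is an equality up to a vector `k ∈ ℤ^d`. -/
def twistedSet {d : ℕ} (A : ℕ+ → Matrix (Fin d) (Fin d) ℤ) (r : ℕ+ → Fin d → ℝ)
    (α : Fin d → ℝ) : Set (Fin d → ℝ) :=
  {β | β ∈ unitCube d ∧ {n : ℕ+ | ∃ x ∈ targetSet r n, ∃ k : Fin d → ℤ,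
    (A n).map (Int.cast : ℤ → ℝ) *ᵥ α = β + x + fun i => (k i : ℝ)}.Infinite}

end

end TwistedApprox

namespace TwistedApprox

/-! Up to a null set, `β` is a point of the torus, and the question is whether it lies in infinitely
many boxes centred at `A_n α` of volume `∏ 2 r_i(n)`. If the volumes are summable, the first
Borel–Cantelli lemma settles every `α`.

If they are not, one bounds the variance of the number of boxes containing `β`, with `β` Haar
distributed and `α` distributed by `μ`. Parseval in `β` gives a sum over `k ≠ 0` of squares of `∑ n,
c_n(k) e(-⟨k, A_n α⟩)`. Under `μ`, the correlation of the characters indexed by `n` and `m` is the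
Fourier transform of `μ` at `(A_n - A_m)ᵀ k`. The singular value and decay hypotheses bound it by
about `1 / (h log_+(h)^(1 + εs))` with `h = |n - m|`, summably in `h` and uniformly in `k`
(`exists_summable_bound`). The Schur test (`lintegral_sq_sum_le`), followed by Parseval for each
box, bounds the variance by a constant times the mean (`lintegral_lintegral_sq_boxCountError_le`). A
Chebyshev argument along finite sets of rapidly growing mean concludes
(`ae_ae_infinite_of_not_summable`). -/

open scoped ENNReal ComplexConjugate

/-! ### Boxes on the torus and their Fourier coefficients. -/

/-- The Haar probability measure on the torus. -/
noncomputable abbrev haarTorus (d : ℕ) : Measure (UnitAddTorus (Fin d)) :=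
  Measure.pi fun _ => AddCircle.haarAddCircle

/-- The product of closed balls around the coordinates of `x` with radii `ρ i`. -/
def torusBox {d : ℕ} (x : UnitAddTorus (Fin d)) (ρ : Fin d → ℝ) : Set (UnitAddTorus (Fin d)) :=
  Set.univ.pi fun i => Metric.closedBall (x i) (ρ i)

variable {d : ℕ}

lemma measurableSet_torusBox (x : UnitAddTorus (Fin d)) (ρ : Fin d → ℝ) :
    MeasurableSet (torusBox x ρ) :=
  MeasurableSet.univ_pi fun _ => Metric.isClosed_closedBall.measurableSet

lemma haarAddCircle_eq_volume :
    (AddCircle.haarAddCircle : Measure UnitAddCircle) = volume := by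
  rw [AddCircle.volume_eq_smul_haarAddCircle]; simp

lemma haarTorus_torusBox (x : UnitAddTorus (Fin d)) {ρ : Fin d → ℝ}
    (hρ : ∀ i, ρ i ∈ Set.Ioo (0 : ℝ) (1 / 2)) :
    haarTorus d (torusBox x ρ) = ENNReal.ofReal (∏ i, 2 * ρ i) := by
  rw [torusBox, haarTorus, Measure.pi_pi, ENNReal.ofReal_prod_of_nonneg]
  · refine Finset.prod_congr rfl fun i _ => ?_
    -- A radius below `1/2` keeps the ball from wrapping around the circle.
    rw [haarAddCircle_eq_volume, AddCircle.volume_closedBall, min_eq_right]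
    linarith [(hρ i).2]
  · intro i _
    linarith [(hρ i).1]

/-- The indicator function of a box on the torus, with complex values. -/
noncomputable def boxIndicator (x : UnitAddTorus (Fin d)) (ρ : Fin d → ℝ) :
    UnitAddTorus (Fin d) → ℂ := (torusBox x ρ).indicator fun _ => 1

lemma memLp_boxIndicator (x : UnitAddTorus (Fin d)) (ρ : Fin d → ℝ) (p : ℝ≥0∞) :
    MemLp (boxIndicator x ρ) p (haarTorus d) :=
  (memLp_const 1).indicator (measurableSet_torusBox x ρ)

/-- The Fourier coefficient of a function on the torus. -/
noncomputable def torusCoeff (f : UnitAddTorus (Fin d) → ℂ) (k : Fin d → ℤ) : ℂ :=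
  ∫ b, UnitAddTorus.mFourier (-k) b * f b ∂haarTorus d

lemma hasSum_sq_torusCoeff {f : UnitAddTorus (Fin d) → ℂ} (hf : MemLp f 2 (haarTorus d)) :
    HasSum (fun k => ‖torusCoeff f k‖ ^ 2) (∫ b, ‖f b‖ ^ 2 ∂haarTorus d) := by
  have h := UnitAddTorus.hasSum_sq_mFourierCoeff (hf.toLp f)
  have hae := hf.coeFn_toLp
  convert! h using 1
  · funext k
    congr 2
    refine integral_congr_ae ?_
    filter_upwards [hae] with b hb
    simp only [smul_eq_mul]
    rw [hb]
  · refine integral_congr_ae ?_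
    filter_upwards [hae] with b hb
    rw [hb]

lemma lintegral_sq_enorm_eq_tsum {f : UnitAddTorus (Fin d) → ℂ} (hf : MemLp f 2 (haarTorus d)) :
    ∫⁻ b, ‖f b‖ₑ ^ 2 ∂haarTorus d = ∑' k, ‖torusCoeff f k‖ₑ ^ 2 := by
  have h := hasSum_sq_torusCoeff hf
  have h1 : ∫⁻ b, ‖f b‖ₑ ^ 2 ∂haarTorus d = ENNReal.ofReal (∫ b, ‖f b‖ ^ 2 ∂haarTorus d) := by
    rw [ofReal_integral_eq_lintegral_ofReal]
    · simp [ENNReal.ofReal_pow]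
    · exact hf.integrable_norm_pow (by norm_num)
    · exact Eventually.of_forall fun _ => by positivity
  rw [h1, ← h.tsum_eq, ENNReal.ofReal_tsum_of_nonneg (fun _ => by positivity) h.summable]
  simp [ENNReal.ofReal_pow]

/-- By translation invariance the centre enters only through a character. This separates the random
centres from the deterministic radii. -/
lemma torusCoeff_boxIndicator (x : UnitAddTorus (Fin d)) (ρ : Fin d → ℝ) (k : Fin d → ℤ) :
    torusCoeff (boxIndicator x ρ) k
      = UnitAddTorus.mFourier (-k) x * torusCoeff (boxIndicator 0 ρ) k := by
  rw [torusCoeff, torusCoeff, ← integral_const_mul,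
    ← integral_add_right_eq_self _ x]
  refine integral_congr_ae (Eventually.of_forall fun b => ?_)
  have h1 : boxIndicator x ρ (b + x) = boxIndicator 0 ρ b := by
    simp only [boxIndicator, Set.indicator]
    congr 1
    simp [torusBox, dist_eq_norm]
  have h2 : UnitAddTorus.mFourier (-k) (b + x)
      = UnitAddTorus.mFourier (-k) b * UnitAddTorus.mFourier (-k) x := by
    simp [UnitAddTorus.mFourier, Finset.prod_mul_distrib, fourier_apply, smul_add,
      AddCircle.toCircle_add, -smul_neg, -neg_smul]
  simp only [h1, h2]
  ring

lemma torusCoeff_const (z : ℂ) {k : Fin d → ℤ} (hk : k ≠ 0) : torusCoeff (fun _ => z) k = 0 := by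
  have h := (orthonormal_iff_ite.1 (UnitAddTorus.orthonormal_mFourier (d := Fin d))) k 0
  simp only [ContinuousMap.inner_toLp, ← UnitAddTorus.mFourier_neg, ← UnitAddTorus.mFourier_add,
    zero_add, if_neg hk] at h
  have h' : ∫ b, UnitAddTorus.mFourier (-k) b ∂haarTorus d = 0 := h
  rw [torusCoeff, integral_mul_const, h', zero_mul]

lemma torusCoeff_zero_boxIndicator (x : UnitAddTorus (Fin d)) {ρ : Fin d → ℝ}
    (hρ : ∀ i, ρ i ∈ Set.Ioo (0 : ℝ) (1 / 2)) :
    torusCoeff (boxIndicator x ρ) 0 = ((∏ i, 2 * ρ i : ℝ) : ℂ) := by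
  have h0 : (0 : ℝ) ≤ ∏ i, 2 * ρ i := Finset.prod_nonneg fun i _ => by linarith [(hρ i).1]
  simp only [torusCoeff, neg_zero, UnitAddTorus.mFourier_zero, ContinuousMap.one_apply, one_mul,
    boxIndicator]
  rw [integral_indicator_const _ (measurableSet_torusBox x ρ), Measure.real,
    haarTorus_torusBox x hρ, ENNReal.toReal_ofReal h0]
  simp

/-- Parseval, for a function equal to its own square: this is what makes the final variance bound
linear in the volumes. -/
lemma tsum_sq_torusCoeff_boxIndicator (x : UnitAddTorus (Fin d)) {ρ : Fin d → ℝ}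
    (hρ : ∀ i, ρ i ∈ Set.Ioo (0 : ℝ) (1 / 2)) :
    ∑' k, ‖torusCoeff (boxIndicator x ρ) k‖ₑ ^ 2 = ENNReal.ofReal (∏ i, 2 * ρ i) := by
  rw [← lintegral_sq_enorm_eq_tsum (memLp_boxIndicator x ρ 2), ← haarTorus_torusBox x hρ]
  rw [← lintegral_indicator_one (measurableSet_torusBox x ρ)]
  refine lintegral_congr fun b => ?_
  simp only [boxIndicator, Set.indicator]
  split_ifs <;> simp

/-! ### The variance of the counting function. -/

/-- The number of boxes containing `b`, minus its mean. -/
noncomputable def boxCountError {ι : Type*} (s : Finset ι) (x : ι → UnitAddTorus (Fin d))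
    (ρ : ι → Fin d → ℝ) (b : UnitAddTorus (Fin d)) : ℂ :=
  ∑ n ∈ s, boxIndicator (x n) (ρ n) b - ((∑ n ∈ s, ∏ i, 2 * ρ n i : ℝ) : ℂ)

lemma memLp_boxCountError {ι : Type*} (s : Finset ι) (x : ι → UnitAddTorus (Fin d))
    (ρ : ι → Fin d → ℝ) (p : ℝ≥0∞) : MemLp (boxCountError s x ρ) p (haarTorus d) :=
  (memLp_finsetSum s fun n _ => memLp_boxIndicator (x n) (ρ n) p).sub (memLp_const _)

lemma norm_mFourier_apply_le (k : Fin d → ℤ) (b : UnitAddTorus (Fin d)) :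
    ‖UnitAddTorus.mFourier k b‖ ≤ 1 :=
  ((UnitAddTorus.mFourier k).norm_coe_le_norm b).trans_eq UnitAddTorus.mFourier_norm

lemma integrable_mFourier_mul {f : UnitAddTorus (Fin d) → ℂ} (hf : MemLp f 1 (haarTorus d))
    (k : Fin d → ℤ) :
    Integrable (fun b => UnitAddTorus.mFourier k b * f b) (haarTorus d) := by
  exact (memLp_one_iff_integrable.1 hf).bdd_mul (c := 1)
    (UnitAddTorus.mFourier k).continuous.aestronglyMeasurable
    (Eventually.of_forall (norm_mFourier_apply_le k))

/-- Subtracting the mean cancels exactly the zero frequency, the one character without decay. -/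
lemma torusCoeff_boxCountError {ι : Type*} (s : Finset ι) (x : ι → UnitAddTorus (Fin d))
    {ρ : ι → Fin d → ℝ} (hρ : ∀ n i, ρ n i ∈ Set.Ioo (0 : ℝ) (1 / 2)) (k : Fin d → ℤ) :
    torusCoeff (boxCountError s x ρ) k = if k = 0 then 0 else
      ∑ n ∈ s, torusCoeff (boxIndicator 0 (ρ n)) k * UnitAddTorus.mFourier (-k) (x n) := by
  have h1 : torusCoeff (boxCountError s x ρ) k
      = ∑ n ∈ s, torusCoeff (boxIndicator (x n) (ρ n)) k
        - torusCoeff (fun _ => ((∑ n ∈ s, ∏ i, 2 * ρ n i : ℝ) : ℂ)) k := by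
    simp only [torusCoeff, boxCountError, mul_sub, Finset.mul_sum]
    rw [integral_sub, integral_finsetSum]
    · exact fun n _ => integrable_mFourier_mul (memLp_boxIndicator _ _ 1) _
    · exact integrable_finsetSum _ fun n _ =>
        integrable_mFourier_mul (memLp_boxIndicator _ _ 1) _
    · exact integrable_mFourier_mul (memLp_const _) _
  split_ifs with hk
  · subst hk
    rw [h1]
    simp only [torusCoeff_zero_boxIndicator _ (hρ _)]
    simp [torusCoeff, UnitAddTorus.mFourier_zero]
  · rw [h1, torusCoeff_const _ hk, sub_zero]
    exact Finset.sum_congr rfl fun n _ => by rw [torusCoeff_boxIndicator, mul_comm]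

lemma lintegral_sq_boxCountError_eq {ι : Type*} (s : Finset ι) (x : ι → UnitAddTorus (Fin d))
    {ρ : ι → Fin d → ℝ} (hρ : ∀ n i, ρ n i ∈ Set.Ioo (0 : ℝ) (1 / 2)) :
    ∫⁻ b, ‖boxCountError s x ρ b‖ₑ ^ 2 ∂haarTorus d = ∑' k, if k = 0 then 0 else
      ‖∑ n ∈ s, torusCoeff (boxIndicator 0 (ρ n)) k * UnitAddTorus.mFourier (-k) (x n)‖ₑ ^ 2 := by
  rw [lintegral_sq_enorm_eq_tsum (memLp_boxCountError s x ρ 2)]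
  refine tsum_congr fun k => ?_
  rw [torusCoeff_boxCountError s x hρ]
  split_ifs <;> simp

/-- A mean square bound for finite sums of almost orthogonal functions (the Schur test). -/
lemma lintegral_sq_sum_le {ι Ω : Type*} [MeasurableSpace Ω] (μ : Measure Ω)
    [IsProbabilityMeasure μ] (s : Finset ι) (c : ι → ℂ) (e : ι → Ω → ℂ)
    (hem : ∀ n, Measurable (e n)) (heb : ∀ n ω, ‖e n ω‖ ≤ 1) (w : ι → ι → ℝ) (W : ℝ)
    (hw : ∀ n m, ‖∫ ω, e n ω * conj (e m ω) ∂μ‖ ≤ w n m)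
    (h1 : ∀ n ∈ s, ∑ m ∈ s, w n m ≤ W) (h2 : ∀ m ∈ s, ∑ n ∈ s, w n m ≤ W) :
    ∫⁻ ω, ‖∑ n ∈ s, c n * e n ω‖ₑ ^ 2 ∂μ ≤ ENNReal.ofReal (W * ∑ n ∈ s, ‖c n‖ ^ 2) := by
  have hint : ∀ n m, Integrable (fun ω => e n ω * conj (e m ω)) μ := fun n m => by
    refine Integrable.of_bound (C := 1)
      ((hem n).mul (Complex.continuous_conj.measurable.comp (hem m))).aestronglyMeasurable
      (Eventually.of_forall fun ω => ?_)
    rw [norm_mul, RCLike.norm_conj]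
    exact mul_le_one₀ (heb n ω) (norm_nonneg _) (heb m ω)
  have hexp : ∀ ω, ((‖∑ n ∈ s, c n * e n ω‖ ^ 2 : ℝ) : ℂ)
      = ∑ n ∈ s, ∑ m ∈ s, c n * conj (c m) * (e n ω * conj (e m ω)) := fun ω => by
    rw [Complex.ofReal_pow, ← Complex.mul_conj', map_sum, Finset.sum_mul_sum]
    refine Finset.sum_congr rfl fun n _ => Finset.sum_congr rfl fun m _ => ?_
    rw [map_mul]; ring
  have hintC : Integrable (fun ω => ((‖∑ n ∈ s, c n * e n ω‖ ^ 2 : ℝ) : ℂ)) μ := by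
    simp only [hexp]
    exact integrable_finsetSum _ fun n _ => integrable_finsetSum _ fun m _ =>
      (hint n m).const_mul _
  have hintR : Integrable (fun ω => ‖∑ n ∈ s, c n * e n ω‖ ^ 2) μ := by
    exact hintC.re
  have hval : ((∫ ω, ‖∑ n ∈ s, c n * e n ω‖ ^ 2 ∂μ : ℝ) : ℂ)
      = ∑ n ∈ s, ∑ m ∈ s, c n * conj (c m) * ∫ ω, e n ω * conj (e m ω) ∂μ := by
    rw [← integral_complex_ofReal]
    simp only [hexp]
    rw [integral_finsetSum _ fun n _ => integrable_finsetSum _ fun m _ => (hint n m).const_mul _]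
    refine Finset.sum_congr rfl fun n _ => ?_
    rw [integral_finsetSum _ fun m _ => (hint n m).const_mul _]
    exact Finset.sum_congr rfl fun m _ => integral_const_mul _ _
  have hw0 : ∀ n m, 0 ≤ w n m := fun n m => (norm_nonneg _).trans (hw n m)
  have hbound : ∫ ω, ‖∑ n ∈ s, c n * e n ω‖ ^ 2 ∂μ ≤ W * ∑ n ∈ s, ‖c n‖ ^ 2 := by
    calc ∫ ω, ‖∑ n ∈ s, c n * e n ω‖ ^ 2 ∂μ
        ≤ ‖((∫ ω, ‖∑ n ∈ s, c n * e n ω‖ ^ 2 ∂μ : ℝ) : ℂ)‖ := by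
          rw [Complex.norm_real]; exact le_abs_self _
      _ ≤ ∑ n ∈ s, ∑ m ∈ s, ‖c n * conj (c m) * ∫ ω, e n ω * conj (e m ω) ∂μ‖ := by
          rw [hval]
          exact (norm_sum_le _ _).trans (Finset.sum_le_sum fun n _ => norm_sum_le _ _)
      -- The inequality `2ab ≤ a² + b²` decouples the coefficients, leaving row sums and column sums
      -- of `w`.
      _ ≤ ∑ n ∈ s, ∑ m ∈ s, (‖c n‖ ^ 2 / 2 * w n m + ‖c m‖ ^ 2 / 2 * w n m) := by
          refine Finset.sum_le_sum fun n _ => Finset.sum_le_sum fun m _ => ?_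
          rw [norm_mul, norm_mul, RCLike.norm_conj, ← add_mul]
          refine mul_le_mul ?_ (hw n m) (norm_nonneg _) (by positivity)
          nlinarith [sq_nonneg (‖c n‖ - ‖c m‖)]
      _ = ∑ n ∈ s, ‖c n‖ ^ 2 / 2 * ∑ m ∈ s, w n m
          + ∑ m ∈ s, ‖c m‖ ^ 2 / 2 * ∑ n ∈ s, w n m := by
          simp only [Finset.sum_add_distrib, Finset.mul_sum]
          congr 1
          exact Finset.sum_comm
      _ ≤ ∑ n ∈ s, ‖c n‖ ^ 2 / 2 * W + ∑ m ∈ s, ‖c m‖ ^ 2 / 2 * W :=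
          add_le_add
            (Finset.sum_le_sum fun n hn => mul_le_mul_of_nonneg_left (h1 n hn) (by positivity))
            (Finset.sum_le_sum fun n hn => mul_le_mul_of_nonneg_left (h2 n hn) (by positivity))
      _ = W * ∑ n ∈ s, ‖c n‖ ^ 2 := by
          rw [← Finset.sum_add_distrib, Finset.mul_sum]
          exact Finset.sum_congr rfl fun n _ => by ring
  calc ∫⁻ ω, ‖∑ n ∈ s, c n * e n ω‖ₑ ^ 2 ∂μ
      = ENNReal.ofReal (∫ ω, ‖∑ n ∈ s, c n * e n ω‖ ^ 2 ∂μ) := by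
        rw [ofReal_integral_eq_lintegral_ofReal hintR
          (Eventually.of_forall fun _ => by positivity)]
        simp [ENNReal.ofReal_pow]
    _ ≤ _ := ENNReal.ofReal_le_ofReal hbound

/-- If every non-trivial character has correlations bounded by a kernel with bounded row and
column sums, the variance of the number of boxes containing a point is at most a constant times
its mean. -/
lemma lintegral_lintegral_sq_boxCountError_le {ι Ω : Type*} [MeasurableSpace Ω] (μ : Measure Ω)
    [IsProbabilityMeasure μ] (s : Finset ι) (x : ι → Ω → UnitAddTorus (Fin d))
    (hx : ∀ n, Measurable (x n))
    {ρ : ι → Fin d → ℝ} (hρ : ∀ n i, ρ n i ∈ Set.Ioo (0 : ℝ) (1 / 2)) (w : ι → ι → ℝ) (W : ℝ)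
    (hW : 0 ≤ W)
    (hw : ∀ k : Fin d → ℤ, k ≠ 0 → ∀ n m, ‖∫ ω, UnitAddTorus.mFourier (-k) (x n ω)
      * conj (UnitAddTorus.mFourier (-k) (x m ω)) ∂μ‖ ≤ w n m)
    (h1 : ∀ n ∈ s, ∑ m ∈ s, w n m ≤ W) (h2 : ∀ m ∈ s, ∑ n ∈ s, w n m ≤ W) :
    AEMeasurable (fun ω => ∫⁻ b, ‖boxCountError s (fun n => x n ω) ρ b‖ₑ ^ 2 ∂haarTorus d) μ ∧
    ∫⁻ ω, ∫⁻ b, ‖boxCountError s (fun n => x n ω) ρ b‖ₑ ^ 2 ∂haarTorus d ∂μ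
      ≤ ENNReal.ofReal (W * ∑ n ∈ s, ∏ i, 2 * ρ n i) := by
  have hem : ∀ (k : Fin d → ℤ) n, Measurable fun ω => UnitAddTorus.mFourier k (x n ω) :=
    fun k n => (UnitAddTorus.mFourier k).continuous.measurable.comp (hx n)
  have hmeas : ∀ k : Fin d → ℤ, Measurable fun ω => if k = 0 then (0 : ℝ≥0∞) else
      ‖∑ n ∈ s, torusCoeff (boxIndicator 0 (ρ n)) k
        * UnitAddTorus.mFourier (-k) (x n ω)‖ₑ ^ 2 := fun k => by
    split_ifs
    · exact measurable_const
    · exact (Finset.measurable_fun_sum s fun n _ => (hem (-k) n).const_mul _).enorm.pow_const 2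
  simp only [lintegral_sq_boxCountError_eq s _ hρ]
  refine ⟨(Measurable.tsum hmeas).aemeasurable, ?_⟩
  rw [lintegral_tsum fun k => (hmeas k).aemeasurable]
  -- The Schur constant `W` does not depend on `k`, so the sum over frequencies can be undone by
  -- Parseval box by box.
  calc _ ≤ ∑' k, ENNReal.ofReal (W * ∑ n ∈ s, ‖torusCoeff (boxIndicator 0 (ρ n)) k‖ ^ 2) := by
        refine ENNReal.tsum_le_tsum fun k => ?_
        split_ifs with hk
        · simp
        · exact lintegral_sq_sum_le μ s _ (fun n ω => UnitAddTorus.mFourier (-k) (x n ω))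
            (hem (-k)) (fun n ω => norm_mFourier_apply_le _ _) w W (hw k hk) h1 h2
    _ = ∑' k, ENNReal.ofReal W * ∑ n ∈ s, ‖torusCoeff (boxIndicator 0 (ρ n)) k‖ₑ ^ 2 := by
        refine tsum_congr fun k => ?_
        rw [ENNReal.ofReal_mul hW, ENNReal.ofReal_sum_of_nonneg fun _ _ => by positivity]
        simp [ENNReal.ofReal_pow]
    _ = ENNReal.ofReal W * ∑ n ∈ s, ENNReal.ofReal (∏ i, 2 * ρ n i) := by
        rw [ENNReal.tsum_mul_left, Summable.tsum_finsetSum fun _ _ => ENNReal.summable]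
        simp only [tsum_sq_torusCoeff_boxIndicator _ (hρ _)]
    _ = _ := by
        rw [ENNReal.ofReal_mul hW, ENNReal.ofReal_sum_of_nonneg]
        exact fun n _ => Finset.prod_nonneg fun i _ => by linarith [(hρ n i).1]

/-! ### Singular values and the decay of correlations. -/

lemma one_le_logPlus (x : ℝ) : 1 ≤ logPlus x := le_max_left _ _

lemma summable_inv_mul_logPlus_rpow {p : ℝ} (hp : 1 < p) :
    Summable fun h : ℕ => (h : ℝ)⁻¹ * logPlus h ^ (-p) := by
  have hpos : ∀ x, 0 < logPlus x := fun x => zero_lt_one.trans_le (one_le_logPlus x)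
  rw [← summable_condensed_iff_of_nonneg]
  · have hl : 0 < Real.log 2 := Real.log_pos one_lt_two
    have h1 : Summable fun k : ℕ => Real.log 2 ^ (-p) * (k : ℝ) ^ (-p) :=
      (Real.summable_nat_rpow.2 (by linarith)).mul_left _
    -- Cauchy condensation gives a `p`-series. The index `k = 0` is skipped because there `0 ^ (-p)
    -- = 0` while the condensed term is `1`.
    refine (summable_nat_add_iff 1).1 (Summable.of_nonneg_of_le (fun k => ?_) (fun k => ?_)
      ((summable_nat_add_iff 1).2 h1))
    · have := hpos ((2 ^ (k + 1) : ℕ) : ℝ)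
      positivity
    · have hk : (0 : ℝ) < ((k + 1 : ℕ) : ℝ) := by positivity
      rw [← Real.mul_rpow hl.le hk.le]
      push_cast
      rw [← mul_assoc, mul_inv_cancel₀ (by positivity), one_mul]
      refine Real.rpow_le_rpow_of_nonpos (by positivity) ?_ (by linarith)
      refine le_trans (le_of_eq ?_) (le_max_right _ _)
      rw [Real.log_pow]; push_cast; ring
  · intro n
    have := hpos n
    positivity
  · intro m n hm hmn
    have hm' : (0 : ℝ) < m := by exact_mod_cast hm
    have hmn' : (m : ℝ) ≤ n := by exact_mod_cast hmn
    refine mul_le_mul (inv_anti₀ hm' hmn') ?_ (Real.rpow_nonneg (hpos _).le _) (by positivity)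
    exact Real.rpow_le_rpow_of_nonpos (hpos _)
      (max_le_max le_rfl (Real.log_le_log hm' hmn')) (by linarith)

lemma smallestSingularValue_mul_norm_le (M : Matrix (Fin d) (Fin d) ℝ) (x : Fin d → ℝ) :
    smallestSingularValue M * ‖WithLp.toLp 2 x‖ ≤ ‖WithLp.toLp 2 (M *ᵥ x)‖ := by
  rcases eq_or_ne x 0 with rfl | hx
  · simp
  have hn : 0 < ‖WithLp.toLp 2 x‖ := norm_pos_iff.2 (by simpa using hx)
  rw [← le_div_iff₀ hn]
  refine csInf_le ⟨0, ?_⟩ ⟨‖WithLp.toLp 2 x‖⁻¹ • x, ?_, ?_⟩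
  · rintro y ⟨_, _, rfl⟩
    exact norm_nonneg _
  · rw [WithLp.toLp_smul, norm_smul, norm_inv, norm_norm, inv_mul_cancel₀ hn.ne']
  · rw [Matrix.mulVec_smul, WithLp.toLp_smul, norm_smul, norm_inv, norm_norm, div_eq_inv_mul]

/-- A square matrix and its transpose have the same singular values, and the frequencies that occur
involve the transpose. Here `M` is invertible, so `k = M x`, and `‖k‖² = ⟨Mᵀ k, x⟩ ≤ ‖Mᵀ k‖ ‖x‖` is
combined with `σ ‖x‖ ≤ ‖k‖`. -/
lemma smallestSingularValue_mul_norm_le_transpose (M : Matrix (Fin d) (Fin d) ℝ)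
    (hM : 0 < smallestSingularValue M) (k : Fin d → ℝ) :
    smallestSingularValue M * ‖WithLp.toLp 2 k‖ ≤ ‖WithLp.toLp 2 (Mᵀ *ᵥ k)‖ := by
  have hinj : Function.Injective M.mulVec := by
    intro x y hxy
    have h := smallestSingularValue_mul_norm_le M (x - y)
    rw [Matrix.mulVec_sub, hxy, sub_self, WithLp.toLp_zero, norm_zero] at h
    have h0 : ‖WithLp.toLp 2 (x - y)‖ = 0 :=
      le_antisymm (nonpos_of_mul_nonpos_right h hM) (norm_nonneg _)
    exact WithLp.toLp_injective 2 (sub_eq_zero.1 (by simpa using h0))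
  obtain ⟨x, rfl⟩ := Matrix.mulVec_surjective_iff_isUnit.2
    (Matrix.mulVec_injective_iff_isUnit.1 hinj) k
  set k := M *ᵥ x with hk
  rcases (norm_nonneg (WithLp.toLp 2 k)).eq_or_lt with h0 | hpos
  · rw [← h0, mul_zero]; exact norm_nonneg _
  have h1 := smallestSingularValue_mul_norm_le M x
  have h2 : ‖WithLp.toLp 2 k‖ ^ 2 ≤ ‖WithLp.toLp 2 (Mᵀ *ᵥ k)‖ * ‖WithLp.toLp 2 x‖ := by
    rw [← real_inner_self_eq_norm_sq]
    refine le_trans (le_of_eq ?_) (real_inner_le_norm _ _)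
    rw [EuclideanSpace.inner_toLp_toLp, EuclideanSpace.inner_toLp_toLp]
    simp only [star_trivial]
    rw [Matrix.mulVec_transpose, dotProduct_comm x, ← Matrix.dotProduct_mulVec]
  refine le_of_mul_le_mul_right ?_ hpos
  calc smallestSingularValue M * ‖WithLp.toLp 2 k‖ * ‖WithLp.toLp 2 k‖
      = smallestSingularValue M * ‖WithLp.toLp 2 k‖ ^ 2 := by ring
    _ ≤ smallestSingularValue M * (‖WithLp.toLp 2 (Mᵀ *ᵥ k)‖ * ‖WithLp.toLp 2 x‖) :=
        mul_le_mul_of_nonneg_left h2 hM.le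
    _ = ‖WithLp.toLp 2 (Mᵀ *ᵥ k)‖ * (smallestSingularValue M * ‖WithLp.toLp 2 x‖) := by ring
    _ ≤ _ := mul_le_mul_of_nonneg_left h1 (norm_nonneg _)

lemma norm_toLp_le_sqrt_mul (t : Fin d → ℝ) : ‖WithLp.toLp 2 t‖ ≤ √d * ‖t‖ := by
  rw [EuclideanSpace.norm_eq]
  refine Real.sqrt_le_iff.2 ⟨by positivity, ?_⟩
  calc ∑ i, ‖t i‖ ^ 2 ≤ ∑ _i : Fin d, ‖t‖ ^ 2 :=
        Finset.sum_le_sum fun i _ => pow_le_pow_left₀ (norm_nonneg _) (norm_le_pi_norm t i) 2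
    _ = (√d * ‖t‖) ^ 2 := by
        rw [mul_pow, Real.sq_sqrt (Nat.cast_nonneg d)]; simp

lemma one_le_norm_toLp_intCast {k : Fin d → ℤ} (hk : k ≠ 0) :
    1 ≤ ‖WithLp.toLp 2 fun i => (k i : ℝ)‖ := by
  obtain ⟨i, hi⟩ := Function.ne_iff.1 hk
  refine le_trans ?_ (PiLp.norm_apply_le (WithLp.toLp 2 fun i => (k i : ℝ)) i)
  simp only [Real.norm_eq_abs, ← Int.cast_abs]
  exact_mod_cast Int.one_le_abs hi

lemma norm_fourierTransform_le_one (μ : Measure (Fin d → ℝ)) [IsProbabilityMeasure μ]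
    (t : Fin d → ℝ) : ‖fourierTransform μ t‖ ≤ 1 := by
  refine (norm_integral_le_of_norm_le_const (C := 1)
    (Eventually.of_forall fun x => le_of_eq ?_)).trans (by simp)
  rw [Complex.norm_exp]
  simp

lemma exists_norm_fourierTransform_le (μ : Measure (Fin d → ℝ)) [IsProbabilityMeasure μ]
    {s : ℝ} (hs : 0 < s)
    (h : fourierTransform μ =O[Bornology.cobounded (Fin d → ℝ)] fun t => ‖t‖ ^ (-s)) :
    ∃ K : ℝ, 0 < K ∧ ∀ t ≠ 0, ‖fourierTransform μ t‖ ≤ K * ‖t‖ ^ (-s) := by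
  obtain ⟨C, hC, hb⟩ := h.exists_pos
  rw [Asymptotics.IsBigOWith, ← comap_norm_atTop, eventually_comap] at hb
  obtain ⟨R, hR⟩ := eventually_atTop.1 hb
  -- The second entry serves `‖t‖ ≤ R`, where the trivial bound is written as `1 = ‖t‖ ^ s * ‖t‖ ^
  -- (-s)`.
  refine ⟨max C ((max R 1) ^ s), lt_max_of_lt_left hC, fun t ht => ?_⟩
  have htn : 0 < ‖t‖ := norm_pos_iff.2 ht
  have hp : 0 < ‖t‖ ^ (-s) := Real.rpow_pos_of_pos htn _
  rcases le_total R ‖t‖ with hRt | hRt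
  · refine (hR ‖t‖ hRt t rfl).trans ?_
    rw [Real.norm_of_nonneg hp.le]
    exact mul_le_mul_of_nonneg_right (le_max_left _ _) hp.le
  · refine (norm_fourierTransform_le_one μ t).trans ?_
    calc (1 : ℝ) = ‖t‖ ^ s * ‖t‖ ^ (-s) := by rw [← Real.rpow_add htn]; simp
      _ ≤ _ := mul_le_mul_of_nonneg_right ((Real.rpow_le_rpow htn.le
          (hRt.trans (le_max_left _ _)) hs.le).trans (le_max_right _ _)) hp.le

/-- The Fourier transform at the frequencies `(A_n - A_m)ᵀ k` is dominated, uniformly in the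
non-zero integral vectors `k`, by a summable function of `n - m`. -/
lemma exists_summable_bound (μ : Measure (Fin d → ℝ)) [IsProbabilityMeasure μ]
    (A : ℕ+ → Matrix (Fin d) (Fin d) ℤ) {c s ε : ℝ} (hc : 0 < c) (hs : 0 < s) (hε : 0 < ε)
    (hA : ∀ m n : ℕ+, m ≠ n →
      c * |(n : ℝ) - (m : ℝ)| ^ (1 / s) * logPlus |(n : ℝ) - (m : ℝ)| ^ (1 / s + ε)
        ≤ smallestSingularValue ((A n - A m).map (Int.cast : ℤ → ℝ)))
    (hdecay : fourierTransform μ =O[Bornology.cobounded (Fin d → ℝ)] fun t => ‖t‖ ^ (-s)) :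
    ∃ φ : ℤ → ℝ, Summable φ ∧ (∀ z, 0 ≤ φ z) ∧ ∀ k : Fin d → ℤ, k ≠ 0 → ∀ n m : ℕ+,
      ‖fourierTransform μ (((A n - A m).map (Int.cast : ℤ → ℝ))ᵀ *ᵥ fun i => (k i : ℝ))‖
        ≤ φ ((n : ℤ) - (m : ℤ)) := by
  obtain ⟨K, hK, hKb⟩ := exists_norm_fourierTransform_le μ hs hdecay
  -- The factor `√d` is the cost of passing from the Euclidean norm to the sup norm.
  set c' : ℝ := c / √d with hc'
  set ψ : ℕ → ℝ := fun h => K * c' ^ (-s) * ((h : ℝ)⁻¹ * logPlus h ^ (-(1 + ε * s))) with hψ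
  have hψs : Summable ψ :=
    (summable_inv_mul_logPlus_rpow (by nlinarith [mul_pos hε hs])).mul_left _
  have hc'0 : 0 ≤ c' := by positivity
  have hψ0 : ∀ h, 0 ≤ ψ h := fun h => by
    have : 0 < logPlus (h : ℝ) := zero_lt_one.trans_le (one_le_logPlus _)
    positivity
  have hsum : Summable fun z : ℤ => ψ z.natAbs := by
    refine Summable.of_nat_of_neg ?_ ?_ <;> simpa using hψs
  have hsingle : Summable fun z : ℤ => if z = 0 then (1 : ℝ) else 0 :=
    summable_of_hasFiniteSupport ((Set.finite_singleton 0).subset fun z hz => by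
      simpa using hz)
  -- Since `0⁻¹ = 0`, `ψ 0` vanishes; the added `1` at `z = 0` covers the diagonal `n = m`.
  refine ⟨fun z => ψ z.natAbs + if z = 0 then 1 else 0, hsum.add hsingle, fun z => ?_, ?_⟩
  · have := hψ0 z.natAbs
    dsimp only
    split_ifs <;> linarith
  intro k hk n m
  rcases eq_or_ne m n with rfl | hmn
  · have := hψ0 ((m : ℤ) - (m : ℤ)).natAbs
    have h1 := norm_fourierTransform_le_one μ
      (((A m - A m).map (Int.cast : ℤ → ℝ))ᵀ *ᵥ fun i => (k i : ℝ))
    simp only [sub_self, if_true] at this h1 ⊢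
    linarith
  have hd : 0 < (d : ℝ) := by
    rcases Nat.eq_zero_or_pos d with rfl | h
    · exact absurd (Subsingleton.elim k 0) hk
    · exact_mod_cast h
  have hzne : (n : ℤ) - (m : ℤ) ≠ 0 := by
    intro h
    exact hmn (PNat.coe_injective (by omega))
  set M : Matrix (Fin d) (Fin d) ℝ := (A n - A m).map (Int.cast : ℤ → ℝ) with hM
  set t : Fin d → ℝ := Mᵀ *ᵥ fun i => (k i : ℝ) with ht
  set h : ℕ := ((n : ℤ) - (m : ℤ)).natAbs with hh
  have hhx : |(n : ℝ) - (m : ℝ)| = (h : ℝ) := by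
    rw [hh, Nat.cast_natAbs]; push_cast; rfl
  have hhpos : (0 : ℝ) < h := by
    exact Nat.cast_pos.2 (Int.natAbs_pos.2 hzne)
  have hL : 0 < logPlus (h : ℝ) := zero_lt_one.trans_le (one_le_logPlus _)
  have hAnm := hA m n hmn
  rw [hhx] at hAnm
  have hc'pos : 0 < c' := div_pos hc (Real.sqrt_pos.2 hd)
  have hσ : 0 < smallestSingularValue M := lt_of_lt_of_le (by positivity) hAnm
  have hlow : c * (h : ℝ) ^ (1 / s) * logPlus h ^ (1 / s + ε) ≤ √d * ‖t‖ := by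
    refine hAnm.trans (le_trans ?_ (norm_toLp_le_sqrt_mul t))
    exact (le_mul_of_one_le_right hσ.le (one_le_norm_toLp_intCast hk)).trans
      (smallestSingularValue_mul_norm_le_transpose M hσ _)
  have hlow' : c' * (h : ℝ) ^ (1 / s) * logPlus h ^ (1 / s + ε) ≤ ‖t‖ := by
    have hsd : 0 < √(d : ℝ) := Real.sqrt_pos.2 hd
    rw [hc', div_mul_eq_mul_div, div_mul_eq_mul_div, div_le_iff₀ hsd, mul_comm ‖t‖]
    exact hlow
  have hpos : 0 < c' * (h : ℝ) ^ (1 / s) * logPlus h ^ (1 / s + ε) := by positivity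
  have ht0 : t ≠ 0 := norm_pos_iff.1 (hpos.trans_le hlow')
  refine (hKb t ht0).trans ?_
  dsimp only
  rw [if_neg hzne, add_zero, hψ]
  dsimp only
  rw [mul_assoc]
  refine mul_le_mul_of_nonneg_left
    ((Real.rpow_le_rpow_of_nonpos hpos hlow' (by linarith)).trans_eq ?_) hK.le
  -- Raising to the power `-s` turns the exponents `1/s` and `1/s + ε` into `-1` and `-(1 + εs)`.
  rw [Real.mul_rpow (by positivity) (by positivity), Real.mul_rpow (by positivity) (by positivity),
    ← Real.rpow_mul hhpos.le, ← Real.rpow_mul hL.le, ← Real.rpow_neg_one (h : ℝ), mul_assoc]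
  congr 3 <;> field_simp

lemma sum_comp_sub_le_tsum {φ : ℤ → ℝ} (hφ : Summable φ) (hφ0 : ∀ z, 0 ≤ φ z) (s : Finset ℕ+)
    {f : ℕ+ → ℤ} (hf : Function.Injective f) : ∑ m ∈ s, φ (f m) ≤ ∑' z, φ z := by
  exact (Finset.sum_map s ⟨f, hf⟩ φ).symm.trans_le (hφ.sum_le_tsum _ fun z _ => hφ0 z)

/-! ### Passage between the unit cube and the torus. -/

/-- The class modulo `ℤ^d` of a vector. -/
def torusPoint (x : Fin d → ℝ) : UnitAddTorus (Fin d) := fun i => (x i : UnitAddCircle)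

lemma measurable_torusPoint : Measurable (torusPoint (d := d)) :=
  measurable_pi_lambda _ fun i => AddCircle.measurable_mk'.comp (measurable_pi_apply i)

lemma mFourier_torusPoint (k : Fin d → ℤ) (x : Fin d → ℝ) :
    UnitAddTorus.mFourier k (torusPoint x)
      = Complex.exp (2 * Real.pi * Complex.I * (((fun i => (k i : ℝ)) ⬝ᵥ x : ℝ) : ℂ)) := by
  simp only [UnitAddTorus.mFourier, ContinuousMap.coe_mk, torusPoint, fourier_coe_apply,
    ← Complex.exp_sum, dotProduct, Complex.ofReal_sum, Finset.mul_sum]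
  congr 1
  refine Finset.sum_congr rfl fun i _ => ?_
  push_cast
  ring

/-- The two characters multiply to `exp(-2πi⟨k, (A - B) α⟩)`, and the matrix moves to the other side
of the pairing as a transpose. -/
lemma integral_mFourier_mul_conj (μ : Measure (Fin d → ℝ)) (A B : Matrix (Fin d) (Fin d) ℤ)
    (k : Fin d → ℤ) :
    ∫ α, UnitAddTorus.mFourier (-k) (torusPoint (A.map (Int.cast : ℤ → ℝ) *ᵥ α))
      * conj (UnitAddTorus.mFourier (-k) (torusPoint (B.map (Int.cast : ℤ → ℝ) *ᵥ α))) ∂μ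
      = fourierTransform μ (((A - B).map (Int.cast : ℤ → ℝ))ᵀ *ᵥ fun i => (k i : ℝ)) := by
  refine integral_congr_ae (Eventually.of_forall fun α => ?_)
  have hk : (fun i => (((-k) i : ℤ) : ℝ)) = -fun i => (k i : ℝ) := by ext i; simp
  have hsub : (A - B).map (Int.cast : ℤ → ℝ)
      = A.map (Int.cast : ℤ → ℝ) - B.map (Int.cast : ℤ → ℝ) := by ext i j; simp
  simp only
  rw [← UnitAddTorus.mFourier_neg, neg_neg, mFourier_torusPoint, mFourier_torusPoint, hk,
    ← Complex.exp_add, hsub, Matrix.mulVec_transpose, ← Matrix.dotProduct_mulVec,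
    Matrix.sub_mulVec, dotProduct_sub, neg_dotProduct]
  congr 1
  push_cast
  ring

lemma measurableSet_unitCube : MeasurableSet (unitCube d) :=
  MeasurableSet.univ_pi' fun _ => measurableSet_Ico

lemma volume_unitCube : volume (unitCube d) = 1 := by
  have h : unitCube d = Set.univ.pi fun _ => Set.Ico (0 : ℝ) 1 := by
    ext x; simp [unitCube]
  rw [h, Real.volume_pi_Ico]
  simp

lemma measurePreserving_torusPoint :
    MeasurePreserving torusPoint (volume.restrict (unitCube d)) (haarTorus d) := by
  have h : unitCube d = Set.univ.pi fun _ => Set.Ico (0 : ℝ) 1 := by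
    ext x; simp [unitCube]
  rw [h, volume_pi, Measure.restrict_pi_pi]
  refine measurePreserving_pi _ _ fun _ => ?_
  rw [Measure.restrict_congr_set (Ico_ae_eq_Ioc (a := (0 : ℝ)) (b := 1)), haarAddCircle_eq_volume]
  simpa using UnitAddCircle.measurePreserving_mk 0

lemma ae_unitCube_of_ae_haarTorus {P : UnitAddTorus (Fin d) → Prop}
    (h : ∀ᵐ b ∂haarTorus d, P b) : ∀ᵐ β : Fin d → ℝ, β ∈ unitCube d → P (torusPoint β) := by
  rw [← ae_restrict_iff' measurableSet_unitCube]
  exact measurePreserving_torusPoint.quasiMeasurePreserving.ae h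

lemma volume_unitCube_inter_eq_zero {P : UnitAddTorus (Fin d) → Prop}
    (h : ∀ᵐ b ∂haarTorus d, ¬ P b) :
    volume {β : Fin d → ℝ | β ∈ unitCube d ∧ P (torusPoint β)} = 0 := by
  rw [measure_eq_zero_iff_ae_notMem]
  filter_upwards [ae_unitCube_of_ae_haarTorus h] with β hβ h'
  exact hβ h'.1 h'.2

lemma volume_unitCube_inter_eq_one {P : UnitAddTorus (Fin d) → Prop}
    (h : ∀ᵐ b ∂haarTorus d, P b) :
    volume {β : Fin d → ℝ | β ∈ unitCube d ∧ P (torusPoint β)} = 1 := by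
  rw [← volume_unitCube (d := d)]
  refine measure_congr ?_
  filter_upwards [ae_unitCube_of_ae_haarTorus h] with β hβ
  exact propext ⟨fun h' => h'.1, fun h' => ⟨h', hβ h'⟩⟩

/-- The distance to the nearest integer is the norm on the circle. Conversely, the fractional and
integer parts of `y - β` supply `x` and `k`. -/
lemma exists_mem_targetSet_iff (r : ℕ+ → Fin d → ℝ) (n : ℕ+) (y β : Fin d → ℝ) :
    (∃ x ∈ targetSet r n, ∃ k : Fin d → ℤ, y = β + x + fun i => (k i : ℝ))
      ↔ torusPoint β ∈ torusBox (torusPoint y) (r n) := by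
  have hbox : torusPoint β ∈ torusBox (torusPoint y) (r n)
      ↔ ∀ i, ‖((y i - β i : ℝ) : UnitAddCircle)‖ ≤ r n i := by
    simp only [torusBox, Set.mem_univ_pi, Metric.mem_closedBall, torusPoint]
    refine forall_congr' fun i => ?_
    rw [dist_comm, dist_eq_norm, AddCircle.coe_sub]
  rw [hbox]
  constructor
  · rintro ⟨x, ⟨-, hx⟩, k, rfl⟩ i
    have h1 : (β + x + fun i => (k i : ℝ)) i - β i = x i + k i := by
      simp only [Pi.add_apply]; ring
    rw [h1, UnitAddCircle.norm_eq, round_add_intCast]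
    refine le_trans (le_of_eq ?_) (hx i)
    rw [distInt]; push_cast; ring_nf
  · intro h
    refine ⟨fun i => Int.fract (y i - β i), ⟨fun i => ⟨Int.fract_nonneg _, Int.fract_lt_one _⟩,
      fun i => ?_⟩, fun i => ⌊y i - β i⌋, ?_⟩
    · have h1 := h i
      rw [UnitAddCircle.norm_eq] at h1
      refine le_trans (le_of_eq ?_) h1
      rw [distInt]
      conv_rhs => rw [← Int.fract_add_floor (y i - β i), round_add_intCast]
      push_cast; ring_nf
    · funext i
      have := Int.fract_add_floor (y i - β i)
      simp only [Pi.add_apply]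
      linarith

lemma twistedSet_eq (A : ℕ+ → Matrix (Fin d) (Fin d) ℤ) (r : ℕ+ → Fin d → ℝ) (α : Fin d → ℝ) :
    twistedSet A r α = {β | β ∈ unitCube d ∧ {n : ℕ+ | torusPoint β ∈
      torusBox (torusPoint ((A n).map (Int.cast : ℤ → ℝ) *ᵥ α)) (r n)}.Infinite} := by
  simp only [twistedSet, exists_mem_targetSet_iff]

/-! ### Borel–Cantelli arguments and the conclusion. -/

lemma ae_finite_of_summable {ρ : ℕ+ → Fin d → ℝ}
    (hρ : ∀ n i, ρ n i ∈ Set.Ioo (0 : ℝ) (1 / 2)) (h : Summable fun n => ∏ i, ρ n i)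
    (x : ℕ+ → UnitAddTorus (Fin d)) :
    ∀ᵐ b ∂haarTorus d, ¬ {n | b ∈ torusBox (x n) (ρ n)}.Infinite := by
  have h2 : Summable fun n => ∏ i, 2 * ρ n i := by
    simpa only [Finset.prod_mul_distrib] using h.mul_left (∏ _i : Fin d, (2 : ℝ))
  have hfin : ∑' n, haarTorus d (torusBox (x n) (ρ n)) ≠ ∞ := by
    simp only [haarTorus_torusBox _ (hρ _)]
    exact h2.tsum_ofReal_ne_top
  have h0 := measure_limsup_cofinite_eq_zero hfin
  rw [measure_eq_zero_iff_ae_notMem] at h0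
  filter_upwards [h0] with b hb hinf
  exact hb (mem_limsup_iff_frequently_mem.2 (frequently_cofinite_iff_infinite.2 hinf))

/-- A second moment form of the divergence Borel–Cantelli lemma for boxes on the torus with
random centres. -/
lemma ae_ae_infinite_of_not_summable {Ω : Type*} [MeasurableSpace Ω] (μ : Measure Ω)
    {ρ : ℕ+ → Fin d → ℝ} (hρ : ∀ n i, ρ n i ∈ Set.Ioo (0 : ℝ) (1 / 2))
    (h : ¬ Summable fun n => ∏ i, ρ n i) (x : ℕ+ → Ω → UnitAddTorus (Fin d)) (W : ℝ) (hW : 0 ≤ W)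
    (hmeas : ∀ s : Finset ℕ+, AEMeasurable
      (fun ω => ∫⁻ b, ‖boxCountError s (fun n => x n ω) ρ b‖ₑ ^ 2 ∂haarTorus d) μ)
    (hvar : ∀ s : Finset ℕ+,
      ∫⁻ ω, ∫⁻ b, ‖boxCountError s (fun n => x n ω) ρ b‖ₑ ^ 2 ∂haarTorus d ∂μ
        ≤ ENNReal.ofReal (W * ∑ n ∈ s, ∏ i, 2 * ρ n i)) :
    ∀ᵐ ω ∂μ, ∀ᵐ b ∂haarTorus d, {n | b ∈ torusBox (x n ω) (ρ n)}.Infinite := by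
  have h2 : ¬ Summable fun n => ∏ i, 2 * ρ n i := by
    simp only [Finset.prod_mul_distrib]
    rwa [summable_mul_left_iff (Finset.prod_ne_zero_iff.2 fun _ _ => two_ne_zero)]
  have hV0 : ∀ n, 0 ≤ ∏ i, 2 * ρ n i := fun n =>
    Finset.prod_nonneg fun i _ => by linarith [(hρ n i).1]
  have hex : ∀ j : ℕ, ∃ s : Finset ℕ+, (2 : ℝ) ^ j < ∑ n ∈ s, ∏ i, 2 * ρ n i := by
    intro j
    by_contra! hcon
    exact h2 (summable_of_sum_le hV0 hcon)
  choose s hs using hex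
  set S : ℕ → ℝ := fun j => ∑ n ∈ s j, ∏ i, 2 * ρ n i with hS
  have hSpos : ∀ j, 0 < S j := fun j => (by positivity : (0 : ℝ) < 2 ^ j).trans (hs j)
  -- Chebyshev normalisation: the `j`-th normalised variance is at most `W / S j ≤ W * 2 ^ (-j)`,
  -- which is summable.
  set q : ℕ → ℝ≥0∞ := fun j => ENNReal.ofReal ((S j ^ 2)⁻¹) with hq
  have hsum : ∫⁻ ω, ∑' j, ∫⁻ b, q j * ‖boxCountError (s j) (fun n => x n ω) ρ b‖ₑ ^ 2
      ∂haarTorus d ∂μ ≠ ∞ := by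
    have hqtop : ∀ j, q j ≠ ∞ := fun j => ENNReal.ofReal_ne_top
    simp only [lintegral_const_mul' _ _ (hqtop _)]
    rw [lintegral_tsum fun j => (hmeas (s j)).const_mul _]
    simp only [lintegral_const_mul' _ _ (hqtop _)]
    have hgeo : Summable fun j : ℕ => W * (1 / 2 : ℝ) ^ j :=
      summable_geometric_two.mul_left W
    refine ne_top_of_le_ne_top hgeo.tsum_ofReal_ne_top (ENNReal.tsum_le_tsum fun j => ?_)
    refine (mul_le_mul_right (hvar (s j)) (q j)).trans ?_
    rw [hq, ← ENNReal.ofReal_mul (by positivity)]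
    refine ENNReal.ofReal_le_ofReal ?_
    have h3 : (S j ^ 2)⁻¹ * (W * S j) = W * (S j)⁻¹ := by
      have := (hSpos j).ne'
      field_simp
    change (S j ^ 2)⁻¹ * (W * S j) ≤ _
    rw [h3, one_div, inv_pow]
    exact mul_le_mul_of_nonneg_left (inv_anti₀ (by positivity) (hs j).le) hW
  have hmeas2 : ∀ j ω, AEMeasurable (fun b =>
      q j * ‖boxCountError (s j) (fun n => x n ω) ρ b‖ₑ ^ 2) (haarTorus d) := fun j ω =>
    ((memLp_boxCountError (s j) (fun n => x n ω) ρ 2).1.enorm.pow_const 2).const_mul _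
  -- A finite double integral makes the series finite for almost every `ω` and then almost every
  -- `b`, so its terms tend to zero.
  have hae := ae_lt_top' (AEMeasurable.tsum fun j => by
    simp only [lintegral_const_mul' (q j) _ ENNReal.ofReal_ne_top]
    exact (hmeas (s j)).const_mul _) hsum
  filter_upwards [hae] with ω hω
  rw [← lintegral_tsum fun j => hmeas2 j ω] at hω
  have hb := ae_lt_top' (AEMeasurable.tsum fun j => hmeas2 j ω) hω.ne
  filter_upwards [hb] with b hb hfin
  have ht := ENNReal.tendsto_atTop_zero_of_tsum_ne_top hb.ne
  -- If `b` lay in only `N` boxes, then as soon as `2N < 2 ^ j < S j` the error would be at least `S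
  -- j / 2`, and the normalised square at least `1/4`.
  set N : ℝ := (hfin.toFinset.card : ℝ) with hN
  have hbig : ∀ᶠ j : ℕ in atTop, 2 * N < (2 : ℝ) ^ j :=
    (tendsto_pow_atTop_atTop_of_one_lt one_lt_two).eventually_gt_atTop _
  have hsmall : ∀ᶠ j in atTop,
      q j * ‖boxCountError (s j) (fun n => x n ω) ρ b‖ₑ ^ 2 < ENNReal.ofReal (1 / 4) :=
    ht.eventually (gt_mem_nhds (by simp))
  obtain ⟨j, hj1, hj2⟩ := (hbig.and hsmall).exists
  have hcount : ‖∑ n ∈ s j, boxIndicator (x n ω) (ρ n) b‖ ≤ N := by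
    calc ‖∑ n ∈ s j, boxIndicator (x n ω) (ρ n) b‖
        ≤ ∑ n ∈ s j, ‖boxIndicator (x n ω) (ρ n) b‖ := norm_sum_le _ _
      _ ≤ ∑ n ∈ s j, if n ∈ hfin.toFinset then (1 : ℝ) else 0 := by
          refine Finset.sum_le_sum fun n _ => ?_
          by_cases h1 : b ∈ torusBox (x n ω) (ρ n)
          · simp [boxIndicator, h1]
          · simp [boxIndicator, h1]
      _ ≤ N := by
          rw [Finset.sum_ite_mem, Finset.sum_const, nsmul_eq_mul, mul_one]
          exact Nat.cast_le.2 (Finset.card_le_card Finset.inter_subset_right)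
  have hlow : S j / 2 ≤ ‖boxCountError (s j) (fun n => x n ω) ρ b‖ := by
    have h1 := norm_sub_norm_le ((S j : ℝ) : ℂ) (∑ n ∈ s j, boxIndicator (x n ω) (ρ n) b)
    rw [norm_sub_rev, Complex.norm_real, Real.norm_of_nonneg (hSpos j).le] at h1
    have h3 := hs j
    change (2 : ℝ) ^ j < S j at h3
    change S j / 2 ≤ ‖∑ n ∈ s j, boxIndicator (x n ω) (ρ n) b - ((S j : ℝ) : ℂ)‖
    linarith
  refine absurd hj2 (not_lt.2 ?_)
  rw [hq, ← ofReal_norm, ← ENNReal.ofReal_pow (norm_nonneg _),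
    ← ENNReal.ofReal_mul (by positivity)]
  refine ENNReal.ofReal_le_ofReal ?_
  have hsq : (S j / 2) ^ 2 ≤ ‖boxCountError (s j) (fun n => x n ω) ρ b‖ ^ 2 :=
    pow_le_pow_left₀ (by linarith [hSpos j]) hlow 2
  rw [inv_mul_eq_div, le_div_iff₀ (by have := hSpos j; positivity)]
  linarith

end TwistedApprox

theorem mainTheorem2 (d : ℕ)
    (r : ℕ+ → Fin d → ℝ) (hr : ∀ n i, r n i ∈ Set.Ioo (0 : ℝ) (1 / 2))
    (hdoubling : TwistedApprox.IsDoubling r)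
    (μ : Measure (Fin d → ℝ)) [IsProbabilityMeasure μ]
    (hμ : μ (TwistedApprox.unitCube d) = 1)
    (A : ℕ+ → Matrix (Fin d) (Fin d) ℤ)
    (c s ε : ℝ) (hc : 0 < c) (hs : 0 < s) (hε : 0 < ε)
    (hA : ∀ m n : ℕ+, m ≠ n →
      c * |(n : ℝ) - (m : ℝ)| ^ (1 / s)
          * TwistedApprox.logPlus |(n : ℝ) - (m : ℝ)| ^ (1 / s + ε)
        ≤ TwistedApprox.smallestSingularValue ((A n - A m).map (Int.cast : ℤ → ℝ)))
    (hdecay : TwistedApprox.fourierTransform μ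
      =O[Bornology.cobounded (Fin d → ℝ)] fun t => ‖t‖ ^ (-s)) :
    ∀ᵐ α ∂μ,
      ((Summable fun n : ℕ+ => ∏ i, r n i) → volume (TwistedApprox.twistedSet A r α) = 0) ∧
      ((¬ Summable fun n : ℕ+ => ∏ i, r n i) → volume (TwistedApprox.twistedSet A r α) = 1) := by
  open TwistedApprox in
  simp only [twistedSet_eq]
  by_cases hsum : Summable fun n : ℕ+ => ∏ i, r n i
  · refine Eventually.of_forall fun α => ⟨fun _ => ?_, fun hn => absurd hsum hn⟩
    exact volume_unitCube_inter_eq_zero (ae_finite_of_summable hr hsum _)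
  obtain ⟨φ, hφ, hφ0, hφb⟩ := exists_summable_bound μ A hc hs hε hA hdecay
  have hx : ∀ n, Measurable fun α : Fin d → ℝ =>
      torusPoint ((A n).map (Int.cast : ℤ → ℝ) *ᵥ α) := fun n =>
    measurable_torusPoint.comp (Continuous.matrix_mulVec continuous_const continuous_id).measurable
  have hW : 0 ≤ ∑' z, φ z := tsum_nonneg hφ0
  -- The kernel depends only on `n - m`, so each row and each column runs injectively through `ℤ`
  -- and `∑' z, φ z` bounds both sums.
  have hvar := fun t : Finset ℕ+ => lintegral_lintegral_sq_boxCountError_le μ t _ hx hr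
    (fun n m : ℕ+ => φ ((n : ℤ) - (m : ℤ))) _ hW
    (fun k hk n m => (congrArg norm (integral_mFourier_mul_conj μ (A n) (A m) k)).trans_le
      (hφb k hk n m))
    (fun n _ => sum_comp_sub_le_tsum hφ hφ0 t fun a b hab =>
      PNat.coe_injective (by simpa using hab))
    (fun m _ => sum_comp_sub_le_tsum hφ hφ0 t fun a b hab =>
      PNat.coe_injective (by simpa using hab))
  filter_upwards [ae_ae_infinite_of_not_summable μ hr hsum _ _ hW (fun t => (hvar t).1)
    fun t => (hvar t).2] with α hα
  exact ⟨fun h => absurd h hsum, fun _ => volume_unitCube_inter_eq_one hα⟩
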